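/- Let $n\ge 1$. A *Gelfand–Tsetlin triangle* of size $n$ is an array $X=(x_{i,j})_{n\ge i\ge j\ge1}$ of positive integers with $x_{i+1,j}\le x_{i,j}\le x_{i+1,j+1}$ for $1\le j\le i\le n-1$. It is a *Gog triangle* if $x_{i,j}<x_{i,j+1}$ for $j<i\le n-1$ and $x_{n,j}=j$ for all $j$, and a *Magog triangle* if $x_{i,i}\le i$ for all $i$. For $1\le k\le n-1$ let $s_k$ be the operator on Gelfand–Tsetlin triangles that only changes row $k$, replacing $x_{k,j}$ by $\max(x_{k+1,j},x_{k-1,j-1})+\min(x_{k+1,j+1},x_{k-1,j})-x_{k,j}$ (undefined entries are ignored); put $\omega_j=s_js_{j-1}\cdots s_1$, and let $S=\omega_1\omega_2\cdots\omega_{n-1}$ be the Schützenberger involution. A *GOGAm triangle* is a Gelfand–Tsetlin triangle $X$ such that $SX$ is a Magog triangle. An $(n,k)$ *Gog trapezoid* is a Gog triangle of size $n$ with $x_{i,j}=j$ whenever $i-j\ge k$; an $(n,k)$ *GOGAm trapezoid* is a GOGAm triangle of size $n$ with $x_{i,j}=1$ whenever $i-j\ge k$. An *inversion* of a Gog triangle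 is a pair $(i,j)$, $1\le j\le i\le n-1$, with $x_{i,j}=x_{i+1,j}$. The inversion $(k,l)$ *covers* $(i,j)$ if $(i,j)=(k+p,l+p)$ for some $1\le p\le n-k$. **The map $\Phi$ on $(n,2)$ Gog trapezoids.** Write $a_k=x_{n-k,n-k}$ and $b_k=x_{n-k+1,n-k}$. Start with $X^{(1)}=(n)$. For $k=1,\dots,n-1$, a triangle $X^{(k)}$ of size $k$ is given, whose entries on its two rightmost lines of direction SW–NE are, from top to bottom, $u_0,\dots,u_{k-1}$ (outer line) and $v_1,\dots,v_{k-1}$ (inner line), all its other entries being $n-k+1$. Put $u_k=a_k$, $v_k=b_k$ and let $Z^{(k)}$ be the array of size $k+1$ obtained by adding the diagonal $(x_{i,n-k})_{i\ge n-k}$ on the left of $X^{(k)}$. Then $X^{(k+1)}$ is the triangle of size $k+1$ with entries $u'_0,\dots,u'_k$ and $v'_1,\dots,v'_k$ on its two rightmost lines and all other entries $n-k$, where $u'_k=u_k$ and * (i) if $v_k=u_k=n-k$: $u'_i=u_i-1$, $v'_i=v_i-1$ for $i<k$, and $v'_k=v_k$; * (ii) if $v_k=n-k<u_k$: $u'_i=u_i$,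 $v'_i=v_i-1$ for $i<k$, and $v'_k=v_k$; * (iii) if $n-k<v_k=u_k$: $u'_i=u_i-1$ for $i<k$; (iiia) if taking $v'_i=v_i$ for all $i\le k$ gives a Gelfand–Tsetlin triangle, do so; (iiib) otherwise $v'_i=v_i-1$ for $i<k$ and $v'_k=n-k$; * (iva) if $n-k<v_k<u_k$ and $v_k\le v_{k-1}$: $u'_i=u_i$, $v'_i=v_i$ for all $i$; * (ivb) if $n-k<v_k<u_k$ and $v_k>v_{k-1}$: $u'_i=u_i$ for all $i$; with $l=\max\{i: v_{k-i}\le v_k-i\}$, $v'_k=\dots=v'_{k-l+1}=n-k$, $v'_{k-l}=v_k-l$, and $v'_i=v_i$ for $i<k-l$. Then $\Phi(X)=X^{(n)}$. **The map $\Psi$ on $(n,2)$ GOGAm trapezoids.** Start with $X^{(n)}$ equal to the given trapezoid. For $k=n-1,\dots,1$, let $u'_0,\dots,u'_k$ and $v'_1,\dots,v'_k$ be the entries of $X^{(k+1)}$ (of size $k+1$) on its two rightmost lines, and let $l=1+\max\{j: v'_{k-j}=n-k\}$ when $v'_k=n-k$. Let $Z^{(k)}$ be the array of size $k+1$ with entries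 $u_0,\dots,u_k$, $v_1,\dots,v_k$ on its two rightmost lines, whose other entries are $n-k$ on the leftmost NW–SE diagonal and $n-k+1$ elsewhere, where $u_k=u'_k$ and * (i) if $v'_k=u'_k=n-k$: $u_i=u'_i+1$, $v_i=v'_i+1$ for $i<k$, and $v_k=v'_k$; * (ii) if $v'_k=n-k<u'_k$ and $v'_i<u'_i$ for all $1\le i<k$: $u_i=u'_i$, $v_i=v'_i+1$ for $i<k$, and $v_k=v'_k$; * (iiia) if $n-k<v'_k=u'_k$: $u_i=u'_i+1$, $v_i=v'_i$ for $i<k$, and $v_k=v'_k$; * (iiib) if $v'_k=n-k<u'_k$, $u'_i=v'_i$ for some $1\le i<k$, and $v'_{k-l}+l\ge u'_k$: $u_i=u'_i+1$, $v_i=v'_i+1$ for $i<k$, and $v_k=u'_k$; * (iva) if $n-k<v'_k<u'_k$: $u_i=u'_i$, $v_i=v'_i$ for all $i$; * (ivb) if $v'_k=n-k<u'_k$, $u'_i=v'_i$ for some $1\le i<k$, and $v'_{k-l}+l<u'_k$: $u_i=u'_i$ for all $i$, $v_i=n-k+1$ for $k-l\le i\le k-1$, $v_k=v'_{k-l}+l$,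 and $v_i=v'_i$ for the other $i$. The leftmost NW–SE diagonal of $Z^{(k)}$ becomes the diagonal number $n-k$ of $\Psi(X)$, and the rest of $Z^{(k)}$ is $X^{(k)}$; finally $X^{(1)}$ is the last diagonal of $\Psi(X)$. **Theorem.** Every $(n,1)$ Gog (resp. GOGAm) trapezoid satisfies the conditions defining $(n,2)$ Gog (resp. GOGAm) trapezoids, and: 1. If $X$ is an $(n,1)$ Gog trapezoid, then at each step of the computation of $\Phi(X)$ the rule applied is (i) or (ii), and for all $1\le j\le i\le n$ the entry $(i,j)$ of $\Phi(X)$ is $x_{i,j}$ minus the number of inversions of $X$ that cover $(i,j)$. 2. $\Phi$ restricts to a bijection from the set of $(n,1)$ Gog trapezoids onto the set of $(n,1)$ GOGAm trapezoids. 3. If $Y$ is an $(n,1)$ GOGAm trapezoid, then at each step of the computation of $\Psi(Y)$ the rule applied is (i) or (ii), and for all $1\le j\le i\le n$ the entry $(i,j)$ of $\Psi(Y)$ is $y_{i,j}$ plus the number of inversions of $\Psi(Y)$ that cover $(i,j)$. 4. $\Psi$ restricts to a bijection from the set of $(n,1)$ GOGAm trapezoids onto the set of $(n,1)$ Gog trapezoids,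 and the restrictions of $\Phi$ and $\Psi$ are inverse to each other. -/

import Mathlib

namespace GogMagog

/-- A triangular array `(x i j)`, `1 ≤ j ≤ i ≤ n`, of integers is stored as a function
`ℕ → ℕ → ℤ`; the predicates below require it to vanish outside the index set, so that a
triangle of size `n` is determined by its entries. -/
abbrev Arr : Type := ℕ → ℕ → ℤ

/-- The part of `x` consisting of the entries `x i j` with `m ≤ j ≤ i ≤ n` (that is, the
NW-SE diagonals number `m, …, n`, which form a triangle of size `n - m + 1`) is a
Gelfand-Tsetlin triangle. -/
abbrev GTFrom (m n : ℕ) (x : Arr) : Prop :=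
  (∀ i ∈ Finset.Icc m n, ∀ j ∈ Finset.Icc m i, 0 < x i j) ∧
  (∀ i ∈ Finset.Icc m n, ∀ j ∈ Finset.Icc m i, i + 1 ≤ n →
    x (i + 1) j ≤ x i j ∧ x i j ≤ x (i + 1) (j + 1))

/-- Gelfand-Tsetlin triangles of size `n`, with positive integer entries. -/
def IsGT (n : ℕ) (x : Arr) : Prop :=
  GTFrom 1 n x ∧ ∀ i j : ℕ, ¬ (1 ≤ j ∧ j ≤ i ∧ i ≤ n) → x i j = 0

/-- Gog triangles of size `n`. -/
def IsGog (n : ℕ) (x : Arr) : Prop :=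
  IsGT n x ∧
  (∀ i j : ℕ, 1 ≤ j → j < i → i + 1 ≤ n → x i j < x i (j + 1)) ∧
  (∀ j : ℕ, 1 ≤ j → j ≤ n → x n j = j)

/-- The set of `(n,k)` Gog trapezoids. -/
def gogTrapezoids (n k : ℕ) : Set Arr :=
  {x | IsGog n x ∧ ∀ i j : ℕ, 1 ≤ j → j + k ≤ i → i ≤ n → x i j = j}

/-- Magog triangles of size `n`. -/
def IsMagog (n : ℕ) (x : Arr) : Prop :=
  IsGT n x ∧ ∀ i : ℕ, 1 ≤ i → i ≤ n → x i i ≤ i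

/-- The operator `s_k`: every entry of row `k` is reflected in the centre of the interval
determined by its neighbours, undefined neighbours being ignored. -/
def s (k : ℕ) (x : Arr) : Arr := fun i j =>
  if i = k ∧ 1 ≤ j ∧ j ≤ k then
    (if 2 ≤ j then max (x (k + 1) j) (x (k - 1) (j - 1)) else x (k + 1) j)
      + (if j + 1 ≤ k then min (x (k + 1) (j + 1)) (x (k - 1) j) else x (k + 1) (j + 1))
      - x k j
  else x i j

/-- `ω_j = s_j s_{j-1} ⋯ s_1`. -/
def omega : ℕ → Arr → Arr
  | 0 => id
  | j + 1 => s (j + 1) ∘ omega j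

/-- `ω_1 ω_2 ⋯ ω_m`. -/
def omegaProd : ℕ → Arr → Arr
  | 0 => id
  | m + 1 => omegaProd m ∘ omega (m + 1)

/-- The Schützenberger involution `S = ω_1 ω_2 ⋯ ω_{n-1}` on triangles of size `n`. -/
def schutzenberger (n : ℕ) : Arr → Arr := omegaProd (n - 1)

/-- GOGAm triangles of size `n`. -/
def IsGOGAm (n : ℕ) (x : Arr) : Prop :=
  IsGT n x ∧ IsMagog n (schutzenberger n x)

/-- The set of `(n,k)` GOGAm trapezoids. -/
def gogamTrapezoids (n k : ℕ) : Set Arr :=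
  {x | IsGOGAm n x ∧ ∀ i j : ℕ, 1 ≤ j → j + k ≤ i → i ≤ n → x i j = 1}

/-- `(k,l)` is an inversion of the triangle `x` of size `n`. -/
abbrev IsInversion (n : ℕ) (x : Arr) (k l : ℕ) : Prop :=
  1 ≤ l ∧ l ≤ k ∧ k + 1 ≤ n ∧ x k l = x (k + 1) l

/-- `(k,l)` covers `(i,j)` in a triangle of size `n`. -/
abbrev Covers (n k l i j : ℕ) : Prop :=
  ∃ p ∈ Finset.Icc 1 (n - k), i = k + p ∧ j = l + p

/-- The number of inversions of `x` which cover `(i,j)`. -/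
def coverCount (n : ℕ) (x : Arr) (i j : ℕ) : ℕ :=
  ((Finset.Icc 1 n ×ˢ Finset.Icc 1 n).filter
    (fun q : ℕ × ℕ => IsInversion n x q.1 q.2 ∧ Covers n q.1 q.2 i j)).card

/-! ### The bijection for `(n,2)` trapezoids

The whole computation is carried out in one array of size `n`.  For the direct map, when
step `k` begins, the entries with `j > n - k` form the triangle `X^(k)`, those with
`j = n - k` are the NW-SE diagonal that is added to it to obtain `Z^(k)`, and those with
`j < n - k` are the entries of the original triangle that are still to be treated. -/

/-- The entry `u_i`: `u_0, u_1, …` run down the right side of the triangle. -/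
def u (n : ℕ) (x : Arr) (i : ℕ) : ℤ := x (n - i) (n - i)

/-- The entry `v_i` (`i ≥ 1`): `v_1, v_2, …` run down the parallel to the right side. -/
def v (n : ℕ) (x : Arr) (i : ℕ) : ℤ := x (n - i + 1) (n - i)

/-- Replace the part `n - k ≤ j` of `x` (a triangle of size `k + 1`) by the triangle with
entries `u' 0, …, u' k` and `v' 1, …, v' k` on the two rightmost SW-NE lines, all the other
entries on the `j`-th NW-SE diagonal being equal to `c j`. -/
def setPart (n k : ℕ) (x : Arr) (c : ℕ → ℤ) (u' v' : ℕ → ℤ) : Arr := fun i j =>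
  if 1 ≤ j ∧ n - k ≤ j ∧ j ≤ i ∧ i ≤ n then
    if i = j then u' (n - j) else if i = j + 1 then v' (n - j) else c j
  else x i j

/-- The names of the rules. -/
inductive Rule
  | i | ii | iiia | iiib | iva | ivb
  deriving DecidableEq

/-- The number `l` of rule (ivb) of the direct map: the largest `i` with
`v_{k-i} ≤ v_k - i`. -/
def ell (n k : ℕ) (z : Arr) : ℕ :=
  ((Finset.range k).filter (fun i => v n z (k - i) ≤ v n z k - i)).sup id

/-- The modification of `Z^(k)` into `X^(k+1)` prescribed by each rule. -/
def applyRule (n k : ℕ) (z : Arr) : Rule → Arr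
  | .i => setPart n k z (fun _ => (n : ℤ) - k)
      (fun i => if i = k then u n z k else u n z i - 1)
      (fun i => if i = k then v n z k else v n z i - 1)
  | .ii => setPart n k z (fun _ => (n : ℤ) - k)
      (fun i => u n z i)
      (fun i => if i = k then v n z k else v n z i - 1)
  | .iiia => setPart n k z (fun _ => (n : ℤ) - k)
      (fun i => if i = k then u n z k else u n z i - 1)
      (fun i => v n z i)
  | .iiib => setPart n k z (fun _ => (n : ℤ) - k)
      (fun i => if i = k then u n z k else u n z i - 1)
      (fun i => if i = k then (n : ℤ) - k else v n z i - 1)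
  | .iva => setPart n k z (fun _ => (n : ℤ) - k)
      (fun i => u n z i)
      (fun i => v n z i)
  | .ivb => setPart n k z (fun _ => (n : ℤ) - k)
      (fun i => u n z i)
      (fun i => if k < i + ell n k z then (n : ℤ) - k
        else if i + ell n k z = k then v n z k - ell n k z
        else v n z i)

/-- The rule that applies to `Z^(k)`. -/
def ruleAt (n k : ℕ) (z : Arr) : Rule :=
  if v n z k = (n : ℤ) - k ∧ u n z k = (n : ℤ) - k then .i
  else if v n z k = (n : ℤ) - k ∧ (n : ℤ) - k < u n z k then .ii
  else if (n : ℤ) - k < v n z k ∧ v n z k = u n z k then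
    if GTFrom (n - k) n (applyRule n k z .iiia) then .iiia else .iiib
  else if (n : ℤ) - k < v n z k ∧ v n z k < u n z k ∧ v n z k ≤ v n z (k - 1) then .iva
  else .ivb

/-- The array after the steps `1, …, k` of the direct map started at `x`. -/
def state (n : ℕ) (x : Arr) : ℕ → Arr
  | 0 => x
  | k + 1 => applyRule n (k + 1) (state n x k) (ruleAt n (k + 1) (state n x k))

/-- The rule applied at step `k` (`1 ≤ k ≤ n - 1`) of the direct map started at `x`. -/
def stepRule (n : ℕ) (x : Arr) (k : ℕ) : Rule := ruleAt n k (state n x (k - 1))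

/-- The map from `(n,2)` Gog trapezoids to `(n,2)` GOGAm trapezoids. -/
def gogToGogam (n : ℕ) (x : Arr) : Arr := state n x (n - 1)

/-! ### The inverse map

Here `k` decreases from `n - 1` to `1`.  Before step `k` the entries with `j ≥ n - k` form
the triangle `X^(k+1)`, and those with `j < n - k` form `Y^(k+1)`; the step replaces
`X^(k+1)` by `Z^(k)`, whose leftmost NW-SE diagonal `j = n - k` is final. -/

/-- The number `l` of the inverse map: one plus the largest `j` with `v'_{k-j} = n - k`. -/
def invEll (n k : ℕ) (x : Arr) : ℕ :=
  1 + ((Finset.range k).filter (fun j => v n x (k - j) = (n : ℤ) - k)).sup id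

/-- The entries of `Z^(k)` outside the two rightmost SW-NE lines. -/
def invBase (n k : ℕ) : ℕ → ℤ := fun j =>
  if j = n - k then (n : ℤ) - k else (n : ℤ) - k + 1

/-- The modification of `X^(k+1)` into `Z^(k)` prescribed by each rule. -/
def applyInvRule (n k : ℕ) (x : Arr) : Rule → Arr
  | .i => setPart n k x (invBase n k)
      (fun i => if i = k then u n x k else u n x i + 1)
      (fun i => if i = k then v n x k else v n x i + 1)
  | .ii => setPart n k x (invBase n k)
      (fun i => u n x i)
      (fun i => if i = k then v n x k else v n x i + 1)
  | .iiia => setPart n k x (invBase n k)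
      (fun i => if i = k then u n x k else u n x i + 1)
      (fun i => v n x i)
  | .iiib => setPart n k x (invBase n k)
      (fun i => if i = k then u n x k else u n x i + 1)
      (fun i => if i = k then u n x k else v n x i + 1)
  | .iva => setPart n k x (invBase n k)
      (fun i => u n x i)
      (fun i => v n x i)
  | .ivb => setPart n k x (invBase n k)
      (fun i => u n x i)
      (fun i => if i = k then v n x (k - invEll n k x) + invEll n k x
        else if k ≤ i + invEll n k x then (n : ℤ) - k + 1
        else v n x i)

/-- `v'_i < u'_i` for all `1 ≤ i < k`. -/
abbrev AllLess (n k : ℕ) (x : Arr) : Prop := ∀ i ∈ Finset.Ico 1 k, v n x i < u n x i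

/-- `u'_i = v'_i` for some `1 ≤ i < k`. -/
abbrev SomeEq (n k : ℕ) (x : Arr) : Prop := ∃ i ∈ Finset.Ico 1 k, u n x i = v n x i

/-- The rule of the inverse map that applies to `X^(k+1)`. -/
def invRuleAt (n k : ℕ) (x : Arr) : Rule :=
  if v n x k = (n : ℤ) - k ∧ u n x k = (n : ℤ) - k then .i
  else if v n x k = (n : ℤ) - k ∧ (n : ℤ) - k < u n x k ∧
      AllLess n k x then .ii
  else if (n : ℤ) - k < v n x k ∧ v n x k = u n x k then .iiia
  else if v n x k = (n : ℤ) - k ∧ (n : ℤ) - k < u n x k ∧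
      SomeEq n k x ∧
      u n x k ≤ v n x (k - invEll n k x) + invEll n k x then .iiib
  else if (n : ℤ) - k < v n x k ∧ v n x k < u n x k then .iva
  else .ivb

/-- The array after the steps `n - 1, n - 2, …, n - m` of the inverse map started at `y`. -/
def invState (n : ℕ) (y : Arr) : ℕ → Arr
  | 0 => y
  | m + 1 => applyInvRule n (n - (m + 1)) (invState n y m)
      (invRuleAt n (n - (m + 1)) (invState n y m))

/-- The rule applied at step `k` (`1 ≤ k ≤ n - 1`) of the inverse map started at `y`. -/
def invStepRule (n : ℕ) (y : Arr) (k : ℕ) : Rule := invRuleAt n k (invState n y (n - 1 - k))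

/-- The inverse map, from `(n,2)` GOGAm trapezoids to `(n,2)` Gog trapezoids. -/
def gogamToGog (n : ℕ) (y : Arr) : Arr := invState n y (n - 1)

end GogMagog

open GogMagog

namespace GogMagog

/-! An `(n,1)` trapezoid is determined by its main diagonal: off it, column `j` is constantly `j`
(Gog) or `1` (GOGAm). The theorem is thus a statement about two kinds of sequences, `GogSeq` and
`GogamSeq`.

In a Gog trapezoid with diagonal `c`, every off-diagonal position above the last row is an
inversion, and `(p,p)` with `p < n` is one exactly when `c p = p`. Hence an off-diagonal entry in
column `j` is covered `j - 1` times and must become `1`, while `c i` must become `d i = c i - #{p <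
i : c p = p}`. The direct map does just this: when column `m` is added, its inner entry is `m` and
`c m` is still untouched, so rule (i) applies if `c m = m` and rule (ii) otherwise. Both lower the
inner line by one; only (i) lowers the later diagonal entries (`ruleAt_gogState`,
`applyRule_gogState`).

Whether `c i = i` can be read off from `d i` and the count of earlier fixed points, so `c` is
recovered from left to right, which is how the inverse map proceeds. That the images match is
`GogSeq.gogamSeq` and `GogamSeq.gogSeq`, once the Magog condition has been translated: `S` reverses
the differences of the diagonal (`schutzenberger_diagArr`). -/

/-- The triangular array of size `n` with diagonal `e` and constant value `f j` on the rest of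
the `j`-th NW-SE diagonal. -/
def diagArr (n : ℕ) (e f : ℕ → ℤ) : Arr := fun i j =>
  if 1 ≤ j ∧ j ≤ i ∧ i ≤ n then (if i = j then e i else f j) else 0

theorem diagArr_congr {n : ℕ} {e e' f f' : ℕ → ℤ} (he : ∀ i, 1 ≤ i → i ≤ n → e i = e' i)
    (hf : ∀ i, 1 ≤ i → i < n → f i = f' i) : diagArr n e f = diagArr n e' f' := by
  funext i j
  unfold diagArr
  split_ifs with h h'
  · exact he i (by omega) (by omega)
  · exact hf j (by omega) (by omega)
  · rfl

theorem diagArr_diag {n : ℕ} {e f : ℕ → ℤ} {i : ℕ} (h1 : 1 ≤ i) (h2 : i ≤ n) :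
    diagArr n e f i i = e i := by
  simp [diagArr, h1, h2]

theorem diagArr_off {n : ℕ} {e f : ℕ → ℤ} {i j : ℕ} (h1 : 1 ≤ j) (h2 : j < i) (h3 : i ≤ n) :
    diagArr n e f i j = f j := by
  simp [diagArr, h1, h2.le, h3, h2.ne']

theorem eq_diagArr {n : ℕ} {x : Arr} {f : ℕ → ℤ}
    (h0 : ∀ i j : ℕ, ¬ (1 ≤ j ∧ j ≤ i ∧ i ≤ n) → x i j = 0)
    (hf : ∀ i j : ℕ, 1 ≤ j → j + 1 ≤ i → i ≤ n → x i j = f j) :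
    x = diagArr n (fun i => x i i) f := by
  funext i j
  unfold diagArr
  split_ifs with h h'
  · rw [h']
  · exact hf i j h.1 (by omega) h.2.2
  · exact h0 i j h

theorem isGT_diagArr {n : ℕ} {e f : ℕ → ℤ} (hf : ∀ i, 1 ≤ i → 1 ≤ f i)
    (hfm : ∀ i, f i ≤ f (i + 1)) (hfe : ∀ i, 1 ≤ i → i ≤ n → f i ≤ e i)
    (he : ∀ i, 1 ≤ i → i + 1 ≤ n → e i ≤ e (i + 1)) : IsGT n (diagArr n e f) := by
  refine ⟨⟨fun i hi j hj => ?_, fun i hi j hj hin => ?_⟩, fun i j h => by simp [diagArr, h]⟩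
  · rw [Finset.mem_Icc] at hi hj
    rcases hj.2.eq_or_lt with rfl | h
    · rw [diagArr_diag hj.1 hi.2]
      linarith [hf j hj.1, hfe j hj.1 hi.2]
    · rw [diagArr_off hj.1 h hi.2]
      linarith [hf j hj.1]
  · rw [Finset.mem_Icc] at hi hj
    rw [diagArr_off hj.1 (by omega) hin]
    rcases hj.2.eq_or_lt with rfl | h
    · rw [diagArr_diag hj.1 hi.2, diagArr_diag (by omega) hin]
      exact ⟨hfe j hj.1 hi.2, he j hj.1 hin⟩
    · rw [diagArr_off hj.1 h hi.2, diagArr_off (by omega) (by omega) hin]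
      exact ⟨le_rfl, hfm j⟩

/-! ### Gog trapezoids encoded by their diagonals. -/

/-- The diagonals of `(n,1)` Gog trapezoids. -/
structure GogSeq (n : ℕ) (c : ℕ → ℤ) : Prop where
  le : ∀ i : ℕ, 1 ≤ i → i ≤ n → (i : ℤ) ≤ c i
  mono : ∀ i : ℕ, 1 ≤ i → i + 1 ≤ n → c i ≤ c (i + 1)
  last : c n = n

/-- The diagonals of `(n,1)` GOGAm trapezoids. -/
structure GogamSeq (n : ℕ) (d : ℕ → ℤ) : Prop where
  pos : ∀ i : ℕ, 1 ≤ i → i ≤ n → 1 ≤ d i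
  mono : ∀ i : ℕ, 1 ≤ i → i + 1 ≤ n → d i ≤ d (i + 1)
  last : d n ≤ n
  sub_le : ∀ m : ℕ, 1 ≤ m → m + 1 ≤ n → d n - d m ≤ n - m - 1

theorem gogTrapezoids_one_eq {n : ℕ} {x : Arr} (hx : x ∈ gogTrapezoids n 1) :
    x = diagArr n (fun i => x i i) (fun j => j) :=
  eq_diagArr hx.1.1.2 hx.2

theorem gogSeq_of_mem {n : ℕ} (hn : 1 ≤ n) {x : Arr} (hx : x ∈ gogTrapezoids n 1) :
    GogSeq n (fun i => x i i) := by
  obtain ⟨⟨⟨⟨h1, h2⟩, h3⟩, h4, h5⟩, h6⟩ := hx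
  have h2' : ∀ i, 1 ≤ i → i + 1 ≤ n → x (i + 1) i ≤ x i i ∧ x i i ≤ x (i + 1) (i + 1) :=
    fun i hi hin => h2 i (Finset.mem_Icc.2 ⟨hi, by omega⟩) i (Finset.mem_Icc.2 ⟨hi, le_rfl⟩) hin
  refine ⟨fun i hi hin => ?_, fun i hi hin => (h2' i hi hin).2, h5 n hn le_rfl⟩
  rcases hin.eq_or_lt with rfl | h
  · exact (h5 i hi le_rfl).ge
  · rw [← h6 (i + 1) i hi le_rfl h]
    exact (h2' i hi h).1

theorem diagArr_mem_gogTrapezoids {n : ℕ} {c : ℕ → ℤ} (hc : GogSeq n c) :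
    diagArr n c (fun j => j) ∈ gogTrapezoids n 1 := by
  refine ⟨⟨isGT_diagArr (fun i hi => by exact_mod_cast hi) (fun i => by simp) hc.le hc.mono,
    fun i j hj hji hin => ?_, fun j hj hjn => ?_⟩,
    fun i j hj hji hin => diagArr_off hj hji hin⟩
  · rw [diagArr_off hj hji (by omega)]
    rcases (show j + 1 ≤ i from hji).eq_or_lt with rfl | h
    · rw [diagArr_diag (by omega) (by omega)]
      have := hc.le (j + 1) (by omega) (by omega)
      push_cast at this
      linarith
    · rw [diagArr_off (by omega) h (by omega)]
      push_cast
      linarith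
  · rcases hjn.eq_or_lt with rfl | h
    · rw [diagArr_diag hj le_rfl, hc.last]
    · rw [diagArr_off hj h le_rfl]

/-! ### The Schützenberger involution on arrays with one nontrivial line -/

/-- An off-diagonal entry of row `k` is confined between `1` and `1`, so it stays put. On the
diagonal, the reflection exchanges the differences `d k - d (k - 1)` and `d (k + 1) - d k`. The
convention `d 0 = 1` makes this hold for `k = 1` too, where the lower neighbour is the entry `1` of
row 2. -/
theorem s_diagArr {n k : ℕ} {d : ℕ → ℤ} (h0 : d 0 = 1)
    (hd : ∀ i, i ≤ n → 1 ≤ d i) (hk : 1 ≤ k) (hkn : k < n) :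
    s k (diagArr n d 1) =
      diagArr n (fun i => if i = k then d (k - 1) + d (k + 1) - d k else d i) 1 := by
  have hd1 := hd (k - 1) (by omega)
  funext i j
  unfold s
  split_ifs with h h2 h3 h4
  · obtain ⟨rfl, h⟩ := h
    rw [diagArr_off (by omega) (by omega) (by omega), diagArr_off (by omega) (by omega) (by omega),
      diagArr_off (by omega) (by omega) (by omega)]
    rcases (show j ≤ i - 1 by omega).eq_or_lt with rfl | h'
    · rw [diagArr_diag (by omega) (by omega), diagArr_off (by omega) (by omega) (by omega),
        diagArr_off (by omega) (by omega) (by omega)]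
      simp [hd1]
    · rw [diagArr_off (by omega) (by omega) (by omega), diagArr_off (by omega) (by omega) (by omega),
        diagArr_off (by omega) (by omega) (by omega)]
      simp
  · obtain ⟨rfl, h⟩ := h
    obtain rfl : j = i := by omega
    rw [diagArr_off (by omega) (by omega) (by omega), diagArr_diag (by omega) (by omega),
      diagArr_diag (by omega) (by omega), diagArr_diag (by omega) (by omega),
      diagArr_diag (by omega) (by omega)]
    simp [hd1]
  · obtain ⟨rfl, h⟩ := h
    obtain rfl : j = 1 := by omega
    rw [diagArr_off (by omega) (by omega) (by omega), diagArr_off (by omega) (by omega) (by omega)]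
    rcases (show 1 ≤ i - 1 by omega).eq_or_lt with h' | h'
    · rw [← h', diagArr_diag (by omega) (by omega), diagArr_off (by omega) (by omega) (by omega),
        diagArr_off (by omega) (by omega) (by omega)]
      simpa using hd 1 (by omega)
    · rw [diagArr_off (by omega) (by omega) (by omega), diagArr_off (by omega) (by omega) (by omega),
        diagArr_off (by omega) (by omega) (by omega)]
      simp
  · obtain ⟨rfl, h⟩ := h
    obtain rfl : j = 1 := by omega
    obtain rfl : i = 1 := by omega
    rw [diagArr_off (by omega) (by omega) (by omega), diagArr_diag (by omega) (by omega),
      diagArr_diag (by omega) (by omega), diagArr_diag (by omega) (by omega)]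
    simp [h0]
  · simp only [diagArr]
    grind

/-- Successive exchanges carry the first difference past the next `j` ones, which each move down one
place. -/
theorem omega_diagArr {n : ℕ} {d : ℕ → ℤ} (h0 : d 0 = 1)
    (hd : ∀ i, i + 1 ≤ n → d i ≤ d (i + 1)) (j : ℕ) (hj : j < n) :
    omega j (diagArr n d 1) =
      diagArr n (fun i => if i ≤ j then d (i + 1) - d 1 + 1 else d i) 1 := by
  have hm : ∀ a b, a ≤ b → b ≤ n → d a ≤ d b := by
    intro a b hab
    induction b, hab using Nat.le_induction with
    | base => exact fun _ => le_rfl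
    | succ b hab ih => exact fun h => (ih (by omega)).trans (hd b h)
  induction j with
  | zero =>
    refine diagArr_congr (fun i h1 h2 => ?_) fun _ _ _ => rfl
    rw [if_neg (by omega)]
  | succ j ih =>
    rw [omega, Function.comp_apply, ih (by omega), s_diagArr (by simp) _ (by omega) hj]
    · refine diagArr_congr (fun i h1 h2 => ?_) fun _ _ _ => rfl
      by_cases hi : i = j + 1
      · subst hi
        simp
        ring
      · by_cases h : i ≤ j
        · simp [h, hi, show i ≤ j + 1 by omega]
        · simp [h, hi, show ¬ i ≤ j + 1 by omega]
    · intro i hi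
      split_ifs
      · linarith [hm 1 (i + 1) (by omega) (by omega)]
      · linarith [hm 0 i (by omega) (by omega)]

/-- In `omegaProd (m + 1)` the factor `omega (m + 1)` acts first and sends the first difference to
position `m + 2`; `omegaProd m` then reverses the `m + 1` differences before it. The induction is
over all `d` because it is applied to the rotated sequence. -/
theorem omegaProd_diagArr {n : ℕ} (m : ℕ) (hm : m < n) {d : ℕ → ℤ} (h0 : d 0 = 1)
    (hd : ∀ i, i + 1 ≤ n → d i ≤ d (i + 1)) :
    omegaProd m (diagArr n d 1) =
      diagArr n (fun i => if i ≤ m + 1 then 1 + d (m + 1) - d (m + 1 - i) else d i) 1 := by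
  induction m generalizing d with
  | zero =>
    refine diagArr_congr (fun i h1 h2 => ?_) fun _ _ _ => rfl
    split_ifs with h
    · obtain rfl : i = 1 := by omega
      simp [h0]
    · rfl
  | succ m ih =>
    rw [omegaProd, Function.comp_apply, omega_diagArr h0 hd _ hm, ih (by omega) (by simp)]
    · refine diagArr_congr (fun i h1 h2 => ?_) fun _ _ _ => rfl
      rcases lt_trichotomy i (m + 2) with h | rfl | h
      · simp [show i ≤ m + 1 by omega, show i ≤ m + 1 + 1 by omega,
          show m + 1 - i + 1 = m + 1 + 1 - i by omega]
        ring
      · simp [h0]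
      · simp [show ¬ i ≤ m + 1 by omega, show ¬ i ≤ m + 1 + 1 by omega]
    · intro i hi
      rcases lt_trichotomy i (m + 1) with h | rfl | h
      · simpa [show i ≤ m + 1 by omega, show i + 1 ≤ m + 1 by omega] using hd (i + 1) (by omega)
      · have := hd 0 (by omega)
        simp at this ⊢
        omega
      · simpa [show ¬ i ≤ m + 1 by omega, show ¬ i + 1 ≤ m + 1 by omega] using hd i hi

/-- The Schützenberger involution reverses the sequence of differences of the diagonal. -/
theorem schutzenberger_diagArr {n : ℕ} (hn : 1 ≤ n) {d : ℕ → ℤ}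
    (hd : ∀ i, 1 ≤ i → i + 1 ≤ n → d i ≤ d (i + 1)) (hp : ∀ i, 1 ≤ i → i ≤ n → 1 ≤ d i) :
    schutzenberger n (diagArr n d 1) =
      diagArr n (fun i => 1 + d n - if i = n then 1 else d (n - i)) 1 := by
  -- The array does not see `d 0`, so it may be set to `1`.
  have h : diagArr n d 1 = diagArr n (fun i => if i = 0 then 1 else d i) 1 :=
    diagArr_congr (fun i h1 _ => by simp [show i ≠ 0 by omega]) fun _ _ _ => rfl
  rw [h, schutzenberger, omegaProd_diagArr _ (by omega) (by simp)]
  · refine diagArr_congr (fun i h1 h2 => ?_) fun _ _ _ => rfl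
    have e : n - 1 + 1 = n := by omega
    have e' : n - i = 0 ↔ i = n := by omega
    simp only [e, h2, if_true, show n ≠ 0 by omega, if_false, e']
  · intro i hi
    rcases Nat.eq_zero_or_pos i with rfl | h
    · simpa using hp 1 le_rfl hi
    · simpa [h.ne'] using hd i h hi

/-! ### GOGAm trapezoids encoded by their diagonals. -/

theorem gogamTrapezoids_one_eq {n : ℕ} {y : Arr} (hy : y ∈ gogamTrapezoids n 1) :
    y = diagArr n (fun i => y i i) 1 :=
  eq_diagArr hy.1.1.2 hy.2

/-- The Magog bound on the reversed diagonal gives `last` in row `n` and `sub_le` in row `n - m`. -/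
theorem gogamSeq_of_mem {n : ℕ} (hn : 1 ≤ n) {y : Arr} (hy : y ∈ gogamTrapezoids n 1) :
    GogamSeq n (fun i => y i i) := by
  have heq := gogamTrapezoids_one_eq hy
  obtain ⟨⟨⟨⟨h1, h2⟩, h3⟩, h4, h5⟩, h6⟩ := hy
  have hp : ∀ i, 1 ≤ i → i ≤ n → 1 ≤ y i i := fun i hi hin =>
    h1 i (Finset.mem_Icc.2 ⟨hi, hin⟩) i (Finset.mem_Icc.2 ⟨hi, le_rfl⟩)
  have hm : ∀ i, 1 ≤ i → i + 1 ≤ n → y i i ≤ y (i + 1) (i + 1) := fun i hi hin =>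
    (h2 i (Finset.mem_Icc.2 ⟨hi, by omega⟩) i (Finset.mem_Icc.2 ⟨hi, le_rfl⟩) hin).2
  rw [heq, schutzenberger_diagArr hn hm hp] at h5
  refine ⟨hp, hm, ?_, fun m hm hmn => ?_⟩
  · have := h5 n hn le_rfl
    rw [diagArr_diag hn le_rfl] at this
    simpa using this
  · have := h5 (n - m) (by omega) (by omega)
    rw [diagArr_diag (by omega) (by omega), if_neg (by omega), show n - (n - m) = m by omega,
      Nat.cast_sub (by omega)] at this
    linarith

theorem diagArr_mem_gogamTrapezoids {n : ℕ} (hn : 1 ≤ n) {d : ℕ → ℤ} (hd : GogamSeq n d) :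
    diagArr n d 1 ∈ gogamTrapezoids n 1 := by
  have hm : ∀ b, ∀ a, 1 ≤ a → a ≤ b → b ≤ n → d a ≤ d b := by
    intro b a ha hab
    induction b, hab using Nat.le_induction with
    | base => exact fun _ => le_rfl
    | succ b hab ih => exact fun h => (ih (by omega)).trans (hd.mono b (by omega) h)
  refine ⟨⟨isGT_diagArr (fun _ _ => le_rfl) (fun _ => le_rfl) hd.pos hd.mono, ?_⟩,
    fun i j hj hji hin => diagArr_off hj hji hin⟩
  rw [schutzenberger_diagArr hn hd.mono hd.pos]
  refine ⟨isGT_diagArr (fun _ _ => le_rfl) (fun _ => le_rfl) (fun i hi hin => ?_)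
    (fun i hi hin => ?_), fun i hi hin => ?_⟩
  · simp only [Pi.one_apply]
    split_ifs
    · linarith [hd.pos n hn le_rfl]
    · linarith [hm n (n - i) (by omega) (by omega) le_rfl]
  · rw [if_neg (by omega)]
    split_ifs
    · linarith [hd.pos (n - i) (by omega) (by omega)]
    · linarith [hm (n - i) (n - (i + 1)) (by omega) (by omega) (by omega)]
  · rw [diagArr_diag hi hin]
    split_ifs with h
    · subst h
      linarith [hd.last]
    · have := hd.sub_le (n - i) (by omega) (by omega)
      rw [Nat.cast_sub hin] at this
      linarith

/-! ### Counting inversions on the diagonal -/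

/-- The number of `p` with `1 ≤ p < i` and `c p = p`. -/
def fixCount (c : ℕ → ℤ) : ℕ → ℤ
  | 0 => 0
  | i + 1 => fixCount c i + if 1 ≤ i ∧ c i = i then 1 else 0

/-- The sequence with `addFix d i = d i + fixCount (addFix d) i`, presented through its
counting function. -/
def addFixCount (d : ℕ → ℤ) : ℕ → ℤ
  | 0 => 0
  | i + 1 => addFixCount d i + if 1 ≤ i ∧ d i + addFixCount d i = i then 1 else 0

theorem fixCount_nonneg (c : ℕ → ℤ) (i : ℕ) : 0 ≤ fixCount c i := by
  induction i with
  | zero => exact le_rfl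
  | succ i ih => rw [fixCount]; split_ifs <;> omega

/-- Both recursions perform the same test at each index; a count up to `n` only inspects indices
below `n`. -/
theorem addFixCount_eq {n : ℕ} {c d : ℕ → ℤ}
    (h : ∀ i, 1 ≤ i → i < n → d i = c i - fixCount c i) (i : ℕ) (hi : i ≤ n) :
    addFixCount d i = fixCount c i := by
  induction i with
  | zero => rfl
  | succ i ih =>
    rw [addFixCount, fixCount, ih (by omega)]
    rcases Nat.eq_zero_or_pos i with rfl | hi'
    · simp
    · rw [h i hi' (by omega)]
      simp

theorem fixCount_eq {n : ℕ} {c d : ℕ → ℤ}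
    (h : ∀ i, 1 ≤ i → i < n → c i = d i + addFixCount d i) (i : ℕ) (hi : i ≤ n) :
    fixCount c i = addFixCount d i := by
  induction i with
  | zero => rfl
  | succ i ih =>
    rw [addFixCount, fixCount, ih (by omega)]
    rcases Nat.eq_zero_or_pos i with rfl | hi'
    · simp
    · rw [h i hi' (by omega)]

/-- If `c i = i`, then `c (i + 1) ≥ i + 1` absorbs the extra unit subtracted, whence monotonicity.
The `-1` in `sub_le` comes from the fixed point at `m` if there is one, and from `c m ≥ m + 1` if
not. -/
theorem GogSeq.gogamSeq {n : ℕ} {c : ℕ → ℤ} (hc : GogSeq n c) :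
    GogamSeq n (fun i => c i - fixCount c i) := by
  have hm : ∀ i : ℕ, 1 ≤ i → i + 1 ≤ n →
      c i - fixCount c i ≤ c (i + 1) - fixCount c (i + 1) := by
    intro i hi hin
    have h1 := hc.mono i hi hin
    have h2 := hc.le (i + 1) (by omega) hin
    push_cast at h2
    rw [fixCount]
    split_ifs with h <;> omega
  have hp : ∀ i : ℕ, 1 ≤ i → i ≤ n → 1 ≤ c i - fixCount c i := by
    intro i hi
    induction i, hi using Nat.le_induction with
    | base => exact fun h => by simpa [fixCount] using hc.le 1 le_rfl h
    | succ i hi ih => exact fun h => (ih (by omega)).trans (hm i hi h)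
  have hf : ∀ a b, a ≤ b → fixCount c a ≤ fixCount c b := fun a b hab =>
    monotone_nat_of_le_succ (fun i => by rw [fixCount]; split_ifs <;> omega) hab
  refine ⟨hp, hm, ?_, fun m hm hmn => ?_⟩
  · linarith [hc.last, fixCount_nonneg c n]
  · have h1 := hf (m + 1) n hmn
    have h2 := hc.le m hm (by omega)
    have h3 := hc.last
    have h4 := hf m (m + 1) (by omega)
    rw [fixCount] at h1 h4
    split_ifs at h1 with h
    · omega
    · have : c m ≠ m := fun h' => h ⟨hm, h'⟩
      omega

/-- The delicate point is that the last entry is at most `n`. If `m` is the last fixed point before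
`n` and `N` the final count, then `d m + N = m + 1`, so `d n + N = d n - d m + m + 1`, and `sub_le`
is exactly the bound needed. -/
theorem GogamSeq.gogSeq {n : ℕ} (hn : 1 ≤ n) {d : ℕ → ℤ} (hd : GogamSeq n d) :
    GogSeq n (fun i => d i + addFixCount d i) := by
  have hm : ∀ i : ℕ, 1 ≤ i → i + 1 ≤ n →
      d i + addFixCount d i ≤ d (i + 1) + addFixCount d (i + 1) := by
    intro i hi hin
    have h1 := hd.mono i hi hin
    rw [addFixCount]
    split_ifs with h <;> omega
  have hle : ∀ i : ℕ, 1 ≤ i → i ≤ n → (i : ℤ) ≤ d i + addFixCount d i := by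
    intro i hi
    induction i, hi using Nat.le_induction with
    | base => exact fun h => by simpa [addFixCount] using hd.pos 1 le_rfl h
    | succ i hi ih =>
      intro hin
      have h1 := ih (by omega)
      have h2 := hd.mono i hi hin
      rw [addFixCount]
      push_cast
      split_ifs with h
      · omega
      · have : d i + addFixCount d i ≠ i := fun h' => h ⟨hi, h'⟩
        omega
  refine ⟨hle, hm, le_antisymm ?_ (hle n hn le_rfl)⟩
  -- either no fixed point occurs before `i`, or the last one bounds the count
  have key : ∀ i : ℕ, i ≤ n → addFixCount d i = 0 ∨
      ∃ m, 1 ≤ m ∧ m + 1 ≤ i ∧ d m + addFixCount d i = m + 1 := by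
    intro i
    induction i with
    | zero => exact fun _ => Or.inl rfl
    | succ i ih =>
      intro hin
      rw [addFixCount]
      split_ifs with h
      · exact Or.inr ⟨i, h.1, le_rfl, by omega⟩
      · rw [add_zero]
        exact (ih (by omega)).imp_right fun ⟨m, h1, h2, h3⟩ => ⟨m, h1, by omega, h3⟩
  rcases key n le_rfl with h | ⟨m, h1, h2, h3⟩
  · linarith [hd.last]
  · linarith [hd.sub_le m h1 h2]

theorem coverCount_eq {n : ℕ} (x : Arr) {i j : ℕ} (hj : 1 ≤ j) (hji : j ≤ i) (hin : i ≤ n) :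
    coverCount n x i j =
      ((Finset.Ico 1 j).filter fun p => x (p + (i - j)) p = x (p + (i - j) + 1) p).card := by
  -- Covering positions lie on the parallel to the main diagonal through `(i, j)`, so their column
  -- determines them.
  rw [coverCount, ← Finset.card_image_of_injective (f := fun p => (p + (i - j), p)) _
    fun a b h => (Prod.ext_iff.1 h).2]
  congr 1
  ext ⟨k, l⟩
  simp only [Finset.mem_filter, Finset.mem_product, Finset.mem_Icc, Finset.mem_image,
    Finset.mem_Ico, IsInversion, Covers, Prod.mk.injEq]
  constructor
  · rintro ⟨-, ⟨h1, h2, h3, h4⟩, p, hp, rfl, rfl⟩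
    have e : l + (k + p - (l + p)) = k := by omega
    exact ⟨l, ⟨by omega, by rw [e, h4]⟩, e, rfl⟩
  · rintro ⟨p, ⟨hp, h⟩, rfl, rfl⟩
    exact ⟨by omega, ⟨hp.1, by omega, by omega, h⟩, j - p, by omega, by omega, by omega⟩

theorem card_filter_fix (c : ℕ → ℤ) (i : ℕ) :
    (((Finset.Ico 1 i).filter fun p => c p = p).card : ℤ) = fixCount c i := by
  induction i with
  | zero => rfl
  | succ i ih =>
    rw [fixCount, ← ih]
    rcases Nat.eq_zero_or_pos i with rfl | hi
    · simp
    · rw [← Finset.insert_Ico_right_eq_Ico_add_one (show 1 ≤ i from hi), Finset.filter_insert]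
      split_ifs <;> simp_all

theorem coverCount_diag {n : ℕ} {c : ℕ → ℤ} {i : ℕ} (h1 : 1 ≤ i) (h2 : i ≤ n) :
    (coverCount n (diagArr n c (fun j => j)) i i : ℤ) = fixCount c i := by
  rw [coverCount_eq _ h1 le_rfl h2, ← card_filter_fix]
  congr 2
  refine Finset.filter_congr fun p hp => ?_
  rw [Finset.mem_Ico] at hp
  rw [Nat.sub_self, add_zero, diagArr_diag hp.1 (by omega), diagArr_off hp.1 (by omega) (by omega)]

theorem coverCount_off {n : ℕ} {c : ℕ → ℤ} {i j : ℕ} (h1 : 1 ≤ j) (h2 : j < i) (h3 : i ≤ n) :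
    (coverCount n (diagArr n c (fun j => j)) i j : ℤ) = j - 1 := by
  rw [coverCount_eq _ h1 h2.le h3, Finset.filter_true_of_mem, Nat.card_Ico, Nat.cast_sub h1,
    Nat.cast_one]
  intro p hp
  rw [Finset.mem_Ico] at hp
  rw [diagArr_off hp.1 (by omega) (by omega), diagArr_off hp.1 (by omega) (by omega)]

/-! ### The direct map -/

/-- The array obtained from the `(n,1)` Gog trapezoid with diagonal `c` after the diagonals
`m, …, n - 1` have been treated. -/
def gogState (n m : ℕ) (c : ℕ → ℤ) : Arr :=
  diagArr n (fun i => c i - if m ≤ i then fixCount c i - fixCount c m else 0)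
    (fun j => if m ≤ j then m else j)

theorem ruleAt_gogState {n m : ℕ} {c : ℕ → ℤ} (hc : GogSeq n c) (hm : 1 ≤ m) (hmn : m + 1 ≤ n) :
    ruleAt n (n - m) (gogState n (m + 1) c) = if c m = m then Rule.i else Rule.ii := by
  have hv : v n (gogState n (m + 1) c) (n - m) = m := by
    rw [v, show n - (n - m) = m by omega, gogState, diagArr_off hm (by omega) hmn]
    simp
  have hu : u n (gogState n (m + 1) c) (n - m) = c m := by
    rw [u, show n - (n - m) = m by omega, gogState, diagArr_diag hm (by omega)]
    simp
  have hnm : (n : ℤ) - ((n - m : ℕ) : ℤ) = m := by omega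
  have := hc.le m hm (by omega)
  rw [ruleAt, hv, hu, hnm]
  split_ifs <;> grind

theorem applyRule_gogState {n m : ℕ} {c : ℕ → ℤ} (hm : 1 ≤ m) (hmn : m + 1 ≤ n) :
    applyRule n (n - m) (gogState n (m + 1) c) (if c m = m then Rule.i else Rule.ii) =
      gogState n m c := by
  have hnm : (n : ℤ) - ((n - m : ℕ) : ℤ) = m := by omega
  have e : ∀ j, j ≤ n → n - (n - j) = j := by omega
  have hf : fixCount c (m + 1) = fixCount c m + if c m = m then 1 else 0 := by
    simp [fixCount, hm]
  funext i j
  by_cases hj : 1 ≤ j ∧ j ≤ i ∧ i ≤ n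
  swap
  · split_ifs <;> simp only [applyRule, setPart, gogState, diagArr, if_neg hj] <;>
      rw [if_neg (by omega)]
  by_cases hmj : m ≤ j
  swap
  · split_ifs <;> simp only [applyRule, setPart] <;> rw [if_neg (by omega)] <;>
      simp [gogState, diagArr, hj] <;> split_ifs <;> first | rfl | omega
  have hs : n - j = n - m ↔ j = m := by omega
  split_ifs at hf ⊢ with h <;>
    simp only [applyRule, setPart, u, v, e j (by omega), e m (by omega), hnm, hs]
  all_goals
    rw [if_pos (by omega)]
    simp only [gogState, diagArr]
    grind

theorem state_diagArr {n : ℕ} {c : ℕ → ℤ} (hc : GogSeq n c) (k : ℕ) (hk : k < n) :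
    state n (diagArr n c (fun j => j)) k = gogState n (n - k) c := by
  induction k with
  | zero =>
    refine diagArr_congr (fun i h1 h2 => ?_) fun i h1 h2 => ?_
    · rcases h2.eq_or_lt with rfl | h
      · simp
      · simp [show ¬ n ≤ i by omega]
    · simp [show ¬ n ≤ i by omega]
  | succ k ih =>
    have h := applyRule_gogState (n := n) (m := n - (k + 1)) (c := c) (by omega) (by omega)
    rw [← ruleAt_gogState hc (by omega) (by omega)] at h
    rw [show n - (k + 1) + 1 = n - k by omega, show n - (n - (k + 1)) = k + 1 by omega] at h
    rw [state, ih (by omega), h]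

theorem stepRule_diagArr {n : ℕ} {c : ℕ → ℤ} (hc : GogSeq n c) {k : ℕ} (hk : 1 ≤ k)
    (hkn : k ≤ n - 1) :
    stepRule n (diagArr n c (fun j => j)) k = Rule.i ∨
      stepRule n (diagArr n c (fun j => j)) k = Rule.ii := by
  have h := ruleAt_gogState hc (m := n - k) (by omega) (by omega)
  rw [show n - k + 1 = n - (k - 1) by omega, show n - (n - k) = k by omega] at h
  rw [stepRule, state_diagArr hc _ (by omega), h]
  split_ifs <;> simp

theorem gogToGogam_diagArr {n : ℕ} (hn : 1 ≤ n) {c : ℕ → ℤ} (hc : GogSeq n c) :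
    gogToGogam n (diagArr n c (fun j => j)) = diagArr n (fun i => c i - fixCount c i) 1 := by
  rw [gogToGogam, state_diagArr hc _ (by omega), show n - (n - 1) = 1 by omega]
  refine diagArr_congr (fun i h1 h2 => ?_) fun i h1 h2 => ?_
  -- Here `m = 1`, and `fixCount c 1 = 0` whatever `c 0` is, since index `0` is never counted.
  · simp [h1, fixCount]
  · simp [h1]

/-! ### The inverse map -/

/-- The array obtained from the `(n,1)` GOGAm trapezoid with diagonal `d` after the diagonals
`1, …, t` have been treated. -/
def gogamState (n t : ℕ) (d : ℕ → ℤ) : Arr :=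
  diagArr n (fun i => d i + if i ≤ t then addFixCount d i else addFixCount d (t + 1))
    (fun j => if j ≤ t then j else t + 1)

theorem invRuleAt_gogamState {n t : ℕ} {d : ℕ → ℤ} (hd : GogamSeq n d)
    (htn : t + 2 ≤ n) :
    invRuleAt n (n - (t + 1)) (gogamState n t d) =
      if d (t + 1) + addFixCount d (t + 1) = (t + 1 : ℕ) then Rule.i else Rule.ii := by
  have hv : ∀ i, 1 ≤ i → i ≤ n - (t + 1) → v n (gogamState n t d) i = t + 1 := by
    intro i hi hit
    rw [v, gogamState, diagArr_off (by omega) (by omega) (by omega), if_neg (by omega)]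
  have hu : ∀ i, i ≤ n - (t + 1) →
      u n (gogamState n t d) i = d (n - i) + addFixCount d (t + 1) := by
    intro i hit
    rw [u, gogamState, diagArr_diag (by omega) (by omega), if_neg (by omega)]
  have hm : ∀ b, t + 1 ≤ b → b ≤ n → d (t + 1) ≤ d b := by
    intro b hab
    induction b, hab using Nat.le_induction with
    | base => exact fun _ => le_rfl
    | succ b hab ih => exact fun h => (ih (by omega)).trans (hd.mono b (by omega) h)
  have hnm : (n : ℤ) - ((n - (t + 1) : ℕ) : ℤ) = t + 1 := by omega
  -- The current diagonal entry is already the final Gog entry, hence at least `t + 1`.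
  have hle := (hd.gogSeq (by omega)).le (t + 1) (by omega) (by omega)
  push_cast at hle
  rw [invRuleAt, hv _ (by omega) le_rfl, hu _ le_rfl, hnm,
    show n - (n - (t + 1)) = t + 1 by omega]
  push_cast
  by_cases h : d (t + 1) + addFixCount d (t + 1) = (t : ℤ) + 1
  · simp [h]
  -- The outer entries weakly increase with the row and the one in row `t + 1` exceeds `t + 1`, the
  -- constant value of the inner line.
  · have hA : AllLess n (n - (t + 1)) (gogamState n t d) := by
      intro i hi
      rw [Finset.mem_Ico] at hi
      rw [hv i hi.1 hi.2.le, hu i hi.2.le]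
      have := hm (n - i) (by omega) (by omega)
      omega
    rw [if_neg (by tauto), if_pos ⟨rfl, by omega, hA⟩, if_neg h]

theorem applyInvRule_gogamState {n t : ℕ} {d : ℕ → ℤ} (htn : t + 2 ≤ n) :
    applyInvRule n (n - (t + 1)) (gogamState n t d)
      (if d (t + 1) + addFixCount d (t + 1) = (t + 1 : ℕ) then Rule.i else Rule.ii) =
      gogamState n (t + 1) d := by
  have hnm : (n : ℤ) - ((n - (t + 1) : ℕ) : ℤ) = t + 1 := by omega
  have e : ∀ j, j ≤ n → n - (n - j) = j := by omega
  have hf : addFixCount d (t + 1 + 1) = addFixCount d (t + 1) +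
      if d (t + 1) + addFixCount d (t + 1) = (t + 1 : ℕ) then 1 else 0 := by
    rw [addFixCount]
    simp
  funext i j
  by_cases hj : 1 ≤ j ∧ j ≤ i ∧ i ≤ n
  swap
  · split_ifs <;> simp only [applyInvRule, setPart, gogamState, diagArr, if_neg hj] <;>
      rw [if_neg (by omega)]
  by_cases hmj : t + 1 ≤ j
  swap
  · split_ifs <;> simp only [applyInvRule, setPart] <;> rw [if_neg (by omega)] <;>
      simp [gogamState, diagArr, hj] <;> split_ifs <;> first | rfl | omega
  have hs : n - j = n - (t + 1) ↔ j = t + 1 := by omega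
  split_ifs at hf ⊢ with h <;>
    simp only [applyInvRule, setPart, invBase, u, v, e j (by omega), e (t + 1) (by omega), hnm, hs]
  all_goals
    rw [if_pos (by omega)]
    simp only [gogamState, diagArr]
    grind

theorem invState_diagArr {n : ℕ} {d : ℕ → ℤ} (hd : GogamSeq n d) (t : ℕ) (ht : t < n) :
    invState n (diagArr n d 1) t = gogamState n t d := by
  induction t with
  | zero =>
    refine diagArr_congr (fun i h1 h2 => ?_) fun i h1 h2 => ?_
    · simp [addFixCount, show i ≠ 0 by omega]
    · simp [show i ≠ 0 by omega]
  | succ t ih =>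
    rw [invState, ih (by omega), invRuleAt_gogamState hd ht, applyInvRule_gogamState ht]

theorem invStepRule_diagArr {n : ℕ} {d : ℕ → ℤ} (hd : GogamSeq n d) {k : ℕ} (hk : 1 ≤ k)
    (hkn : k ≤ n - 1) :
    invStepRule n (diagArr n d 1) k = Rule.i ∨ invStepRule n (diagArr n d 1) k = Rule.ii := by
  have h := invRuleAt_gogamState hd (t := n - 1 - k) (by omega)
  rw [show n - (n - 1 - k + 1) = k by omega] at h
  rw [invStepRule, invState_diagArr hd _ (by omega), h]
  split_ifs <;> simp

theorem gogamToGog_diagArr {n : ℕ} (hn : 1 ≤ n) {d : ℕ → ℤ} (hd : GogamSeq n d) :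
    gogamToGog n (diagArr n d 1) = diagArr n (fun i => d i + addFixCount d i) (fun j => j) := by
  rw [gogamToGog, invState_diagArr hd _ (by omega)]
  refine diagArr_congr (fun i h1 h2 => ?_) fun i h1 h2 => ?_
  · rcases h2.eq_or_lt with rfl | h
    -- The corner entry is never the left diagonal of a step; it has received the total `addFixCount
    -- d n`.
    · simp [show ¬ i ≤ i - 1 by omega, show i - 1 + 1 = i by omega]
    · simp [show i ≤ n - 1 by omega]
  · simp [show i ≤ n - 1 by omega]

/-! ### The two maps as mutually inverse bijections. -/

theorem invOn_gogamToGog {n : ℕ} (hn : 1 ≤ n) :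
    Set.InvOn (gogamToGog n) (gogToGogam n) (gogTrapezoids n 1) (gogamTrapezoids n 1) := by
  constructor
  · intro x hx
    have hc := gogSeq_of_mem hn hx
    rw [gogTrapezoids_one_eq hx, gogToGogam_diagArr hn hc,
      gogamToGog_diagArr hn (hc.gogamSeq)]
    refine diagArr_congr (fun i h1 h2 => ?_) fun _ _ _ => rfl
    rw [addFixCount_eq (fun _ _ _ => rfl) i h2]
    ring
  · intro y hy
    have hd := gogamSeq_of_mem hn hy
    rw [gogamTrapezoids_one_eq hy, gogamToGog_diagArr hn hd,
      gogToGogam_diagArr hn (hd.gogSeq hn)]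
    refine diagArr_congr (fun i h1 h2 => ?_) fun _ _ _ => rfl
    rw [fixCount_eq (fun _ _ _ => rfl) i h2]
    ring

theorem mapsTo_gogToGogam {n : ℕ} (hn : 1 ≤ n) :
    Set.MapsTo (gogToGogam n) (gogTrapezoids n 1) (gogamTrapezoids n 1) := by
  intro x hx
  have hc := gogSeq_of_mem hn hx
  rw [gogTrapezoids_one_eq hx, gogToGogam_diagArr hn hc]
  exact diagArr_mem_gogamTrapezoids hn (hc.gogamSeq)

theorem mapsTo_gogamToGog {n : ℕ} (hn : 1 ≤ n) :
    Set.MapsTo (gogamToGog n) (gogamTrapezoids n 1) (gogTrapezoids n 1) := by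
  intro y hy
  have hd := gogamSeq_of_mem hn hy
  rw [gogamTrapezoids_one_eq hy, gogamToGog_diagArr hn hd]
  exact diagArr_mem_gogTrapezoids (hd.gogSeq hn)

theorem gogToGogam_apply {n : ℕ} (hn : 1 ≤ n) {x : Arr} (hx : x ∈ gogTrapezoids n 1) {i j : ℕ}
    (hj : 1 ≤ j) (hji : j ≤ i) (hin : i ≤ n) :
    gogToGogam n x i j = x i j - (coverCount n x i j : ℤ) := by
  have hc := gogSeq_of_mem hn hx
  rw [gogTrapezoids_one_eq hx, gogToGogam_diagArr hn hc]
  rcases hji.eq_or_lt with rfl | h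
  · rw [coverCount_diag hj hin, diagArr_diag hj hin, diagArr_diag hj hin]
  · rw [coverCount_off hj h hin, diagArr_off hj h hin, diagArr_off hj h hin]
    simp

end GogMagog

theorem mainTheorem4 (n : ℕ) (hn : 1 ≤ n) :
    -- the `(n,1)` trapezoids are among the `(n,2)` trapezoids, on which the maps are defined
    gogTrapezoids n 1 ⊆ gogTrapezoids n 2 ∧
    gogamTrapezoids n 1 ⊆ gogamTrapezoids n 2 ∧
    -- direct map: rules, image, effect on the entries
    (∀ x ∈ gogTrapezoids n 1,
      (∀ k : ℕ, 1 ≤ k → k ≤ n - 1 → stepRule n x k = Rule.i ∨ stepRule n x k = Rule.ii) ∧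
      (∀ i j : ℕ, 1 ≤ j → j ≤ i → i ≤ n →
        gogToGogam n x i j = x i j - (coverCount n x i j : ℤ))) ∧
    Set.BijOn (gogToGogam n) (gogTrapezoids n 1) (gogamTrapezoids n 1) ∧
    -- inverse map: rules, image, effect on the entries
    (∀ y ∈ gogamTrapezoids n 1,
      (∀ k : ℕ, 1 ≤ k → k ≤ n - 1 →
        invStepRule n y k = Rule.i ∨ invStepRule n y k = Rule.ii) ∧
      (∀ i j : ℕ, 1 ≤ j → j ≤ i → i ≤ n →
        gogamToGog n y i j = y i j + (coverCount n (gogamToGog n y) i j : ℤ))) ∧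
    Set.BijOn (gogamToGog n) (gogamTrapezoids n 1) (gogTrapezoids n 1) ∧
    Set.InvOn (gogamToGog n) (gogToGogam n) (gogTrapezoids n 1) (gogamTrapezoids n 1) := by
  refine ⟨fun x hx => ⟨hx.1, fun i j h1 h2 h3 => hx.2 i j h1 (by omega) h3⟩,
    fun x hx => ⟨hx.1, fun i j h1 h2 h3 => hx.2 i j h1 (by omega) h3⟩,
    fun x hx => ⟨fun k hk hkn => ?_, fun i j hj hji hin => gogToGogam_apply hn hx hj hji hin⟩,
    (invOn_gogamToGog hn).bijOn (mapsTo_gogToGogam hn) (mapsTo_gogamToGog hn),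
    fun y hy => ⟨fun k hk hkn => ?_, fun i j hj hji hin => ?_⟩,
    (invOn_gogamToGog hn).symm.bijOn (mapsTo_gogamToGog hn) (mapsTo_gogToGogam hn),
    invOn_gogamToGog hn⟩
  · rw [gogTrapezoids_one_eq hx]
    exact stepRule_diagArr (gogSeq_of_mem hn hx) hk hkn
  · rw [gogamTrapezoids_one_eq hy]
    exact invStepRule_diagArr (gogamSeq_of_mem hn hy) hk hkn
  -- The formula for the inverse map is that of the direct map at `gogamToGog n y`, whose image is
  -- `y`.
  · have h := gogToGogam_apply hn (mapsTo_gogamToGog hn hy) hj hji hin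
    rw [(invOn_gogamToGog hn).2 hy] at h
    linarith
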